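/- Let $\mathcal H$ be a complex Hilbert space with inner product linear in the second argument. A densely defined operator $B$ on $\mathcal H$ is called dissipative if $\operatorname{Im}\langle f,Bf\rangle\ge 0$ for all $f\in\mathcal D(B)$, and an operator $C$ is called accretive if $iC$ is dissipative. Let $S$ be a densely defined symmetric operator on $\mathcal H$ that is strictly positive, i.e. there is $\varepsilon>0$ with $\langle f,Sf\rangle\ge\varepsilon\|f\|^2$ for all $f\in\mathcal D(S)$, and put $A=iS$. Let $S_F$ be the Friedrichs extension of $S$ (the restriction of $S^*$ to the elements of $\mathcal D(S^*)$ lying in the domain of the closure of the form $f\mapsto\langle f,Sf\rangle$, $f\in\mathcal D(S)$), let $S_K$ be its Kreĭn–von Neumann extension, $S_K=S^*\upharpoonright_{\mathcal D(\overline S)\dot+\ker S^*}$, and let $S_K^{1/2}$ be the non-negative selfadjoint square root of $S_K$ (which exists, and $\mathcal D(S_F)\subset\mathcal D(S_K^{1/2})$). For a subspace $\mathcal V\subset\mathcal D(S_K^{1/2})$ with $\mathcal V\cap\mathcal D(A)=\{0\}$ and a linear operator $\mathcal L:\mathcal V\to\mathcal D(S_F)$ define $$A_{\mathcal V,\mathcal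 L}:\quad \mathcal D(A_{\mathcal V,\mathcal L})=\mathcal D(A)\dot+\mathcal V,\qquad f+v\mapsto iSf+iS_F\mathcal Lv\qquad(f\in\mathcal D(A),\ v\in\mathcal V).$$ For every such pair $(\mathcal V,\mathcal L)$, the operator $A_{\mathcal V,\mathcal L}$ is dissipative if and only if $$\operatorname{Re}\langle v,S_F\mathcal Lv\rangle\ \ge\ \tfrac14\,\|S_K^{1/2}(\mathcal Lv+v)\|^2\qquad\text{for all } v\in\mathcal V. \tag{$*$}$$ Moreover, an operator $B$ on $\mathcal H$ is a dissipative extension of $A$ if and only if $B=A_{\mathcal V,\mathcal L}$ for some such pair $(\mathcal V,\mathcal L)$ satisfying $(*)$. Equivalently, an operator $C$ on $\mathcal H$ is an accretive extension of $S$ if and only if $C=-iA_{\mathcal V,\mathcal L}$ for some such pair $(\mathcal V,\mathcal L)$ satisfying $(*)$. -/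

import Mathlib

noncomputable section

open Filter Topology Complex

namespace DissipativeExtension

variable {H : Type*} [NormedAddCommGroup H] [InnerProductSpace ℂ H]

/-- A densely defined operator `A` is dissipative if `Im ⟨f, A f⟩ ≥ 0` for all `f ∈ D(A)`. -/
structure IsDissipative (A : H →ₗ.[ℂ] H) : Prop where
  dense : Dense (A.domain : Set H)
  im_nonneg : ∀ f : A.domain, 0 ≤ (inner ℂ (f : H) (A f)).im

/-- An operator `C` is accretive if `i C` is dissipative. -/
def IsAccretive (C : H →ₗ.[ℂ] H) : Prop := IsDissipative (I • C)

/-- A densely defined symmetric operator `S` with `⟨f, S f⟩ ≥ ε ‖f‖²` on `D(S)` for some `ε > 0`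
(the number `⟨f, S f⟩` is real by symmetry). -/
structure IsStrictlyPositiveSymmetric (S : H →ₗ.[ℂ] H) : Prop where
  dense : Dense (S.domain : Set H)
  symmetric : S.IsFormalAdjoint S
  strictly_positive : ∃ ε : ℝ, 0 < ε ∧
    ∀ f : S.domain, ε * ‖(f : H)‖ ^ 2 ≤ (inner ℂ (f : H) (S f)).re

/-- The quadratic form `f ↦ ⟨f, S f⟩` of a symmetric operator, with domain `D(S)`. -/
def quadForm (S : H →ₗ.[ℂ] H) (f : S.domain) : ℝ := (inner ℂ (f : H) (S f)).re

theorem quadForm_add_add_sub (S : H →ₗ.[ℂ] H) (f g : S.domain) :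
    quadForm S (f + g) + quadForm S (f - g) = 2 * quadForm S f + 2 * quadForm S g := by
  simp only [quadForm, Submodule.coe_add, Submodule.coe_sub, LinearPMap.map_add,
    LinearPMap.map_sub, inner_add_left, inner_add_right, inner_sub_left, inner_sub_right,
    Complex.add_re, Complex.sub_re]
  ring

theorem quadForm_smul (S : H →ₗ.[ℂ] H) (c : ℂ) (f : S.domain) :
    quadForm S (c • f) = ‖c‖ ^ 2 * quadForm S f := by
  simp only [quadForm, Submodule.coe_smul, LinearPMap.map_smul, inner_smul_left,
    inner_smul_right]
  rw [← mul_assoc, Complex.mul_conj, Complex.re_ofReal_mul,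
    Complex.normSq_eq_norm_sq]

theorem IsStrictlyPositiveSymmetric.quadForm_nonneg {S : H →ₗ.[ℂ] H}
    (hS : IsStrictlyPositiveSymmetric S) (f : S.domain) : 0 ≤ quadForm S f := by
  obtain ⟨ε, hε, h⟩ := hS.strictly_positive
  exact le_trans (by positivity) (h f)

/-- The domain of the closure of the form `f ↦ ⟨f, S f⟩`: all limits in `H` of sequences in `D(S)`
that are Cauchy for the form. -/
def closedFormDomain {S : H →ₗ.[ℂ] H} (hS : IsStrictlyPositiveSymmetric S) : Submodule ℂ H where
  carrier := {f | ∃ u : ℕ → S.domain, Tendsto (fun n => (u n : H)) atTop (𝓝 f) ∧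
    Tendsto (fun p : ℕ × ℕ => quadForm S (u p.1 - u p.2)) atTop (𝓝 0)}
  zero_mem' := ⟨fun _ => 0, by simp, by simp [quadForm]⟩
  add_mem' := by
    rintro f g ⟨u, hu, hu'⟩ ⟨w, hw, hw'⟩
    refine ⟨fun n => u n + w n, by simpa using hu.add hw, ?_⟩
    have hlim : Tendsto (fun p : ℕ × ℕ =>
        2 * quadForm S (u p.1 - u p.2) + 2 * quadForm S (w p.1 - w p.2)) atTop (𝓝 0) := by
      simpa using (hu'.const_mul 2).add (hw'.const_mul 2)
    refine squeeze_zero (fun p => hS.quadForm_nonneg _) (fun p => ?_) hlim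
    rw [add_sub_add_comm, ← quadForm_add_add_sub]
    exact le_add_of_nonneg_right (hS.quadForm_nonneg _)
  smul_mem' := by
    rintro c f ⟨u, hu, hu'⟩
    refine ⟨fun n => c • u n, by simpa using hu.const_smul c, ?_⟩
    have hlim := hu'.const_mul (‖c‖ ^ 2)
    rw [mul_zero] at hlim
    refine hlim.congr fun p => ?_
    rw [← smul_sub, quadForm_smul]

variable [CompleteSpace H]

/-- The Friedrichs extension `S_F`: the restriction of `S*` to those elements of `D(S*)` that lie
in the domain of the closed form generated by `S`. -/
def friedrichs {S : H →ₗ.[ℂ] H} (hS : IsStrictlyPositiveSymmetric S) : H →ₗ.[ℂ] H :=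
  S.adjoint.domRestrict (closedFormDomain hS)

/-- The kernel of a partially defined operator, as a subspace of `H`. -/
def kernel (T : H →ₗ.[ℂ] H) : Submodule ℂ H := (LinearMap.ker T.toFun).map T.domain.subtype

/-- The Kreĭn–von Neumann extension `S_K`: the restriction of `S*` to `D(S̄) + ker S*`. -/
def krein (S : H →ₗ.[ℂ] H) : H →ₗ.[ℂ] H :=
  S.adjoint.domRestrict (S.closure.domain ⊔ kernel S.adjoint)

/-- `R` is a non-negative selfadjoint square root of `T`: one has `R² = T`, where
`D(R²) = {x ∈ D(R) | R x ∈ D(R)}`. -/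
structure IsNonnegSqrt (T R : H →ₗ.[ℂ] H) : Prop where
  selfAdjoint : IsSelfAdjoint R
  nonneg : ∀ x : R.domain, 0 ≤ (inner ℂ (x : H) (R x)).re
  sq_eq : ∀ x y : H, (x, y) ∈ T.graph ↔ ∃ z : H, (x, z) ∈ R.graph ∧ (z, y) ∈ R.graph

open Classical in
/-- The square root `T^{1/2}` of a non-negative selfadjoint operator `T`, i.e. its (unique)
non-negative selfadjoint square root; the value is `0` if there is none. -/
def sqrt (T : H →ₗ.[ℂ] H) : H →ₗ.[ℂ] H :=
  if h : ∃ R, IsNonnegSqrt T R then h.choose else 0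

/-- A pair `(𝒱, ℒ)`: a subspace `𝒱 ⊆ D(S_K^{1/2})` with `𝒱 ∩ D(S) = {0}` and a linear operator
`ℒ : 𝒱 → D(S_F)`. -/
structure ExtensionData {S : H →ₗ.[ℂ] H} (hS : IsStrictlyPositiveSymmetric S) where
  V : Submodule ℂ H
  V_le : V ≤ (sqrt (krein S)).domain
  disjoint : Disjoint S.domain V
  L : V →ₗ[ℂ] (friedrichs hS).domain

variable {S : H →ₗ.[ℂ] H} {hS : IsStrictlyPositiveSymmetric S}

/-- The operator `v ↦ i S_F ℒ v` with domain `𝒱`. -/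
def ExtensionData.onV (P : ExtensionData hS) : H →ₗ.[ℂ] H :=
  ⟨P.V, I • ((friedrichs hS).toFun ∘ₗ P.L)⟩

/-- The operator `A_{𝒱,ℒ}` with domain `D(S) ∔ 𝒱` and `f + v ↦ i S f + i S_F ℒ v`. -/
def ExtensionData.op (P : ExtensionData hS) : H →ₗ.[ℂ] H :=
  LinearPMap.sup (I • S) P.onV (LinearPMap.sup_h_of_disjoint _ _ P.disjoint)

/-- The condition `Re ⟨v, S_F ℒ v⟩ ≥ ¼ ‖S_K^{1/2} (ℒ v + v)‖²` for all `v ∈ 𝒱`, where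
`ℒ v + v ∈ D(S_K^{1/2})` is included for the right-hand side to make sense. -/
def ExtensionData.Condition (P : ExtensionData hS) : Prop :=
  ∀ v : P.V, ∃ h : (P.L v : H) + (v : H) ∈ (sqrt (krein S)).domain,
    (1 / 4 : ℝ) * ‖sqrt (krein S) ⟨(P.L v : H) + (v : H), h⟩‖ ^ 2 ≤
      (inner ℂ (v : H) (friedrichs hS (P.L v))).re

end DissipativeExtension

end

open DissipativeExtension

/-! Write q(f) = ⟨f, Sf⟩ and u = ℒv + v. Since S_F ⊂ S*, the mixed terms of Im⟨f + v, iSf + iS_F ℒv⟩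
combine, and it equals q(f) + Re⟨v, S_F ℒv⟩ + Re⟨u, Sf⟩ (`im_inner_I_smul`). For fixed v,
dissipativity is thus a lower bound for q(f) + Re⟨u, Sf⟩ over f ∈ D(S), and everything rests on its
infimum being -¼‖S_K^{1/2}u‖², or -∞ when u ∉ D(S_K^{1/2}).

On D(S) one has q(f) = ‖S_K^{1/2}f‖² and, for u ∈ D(S_K^{1/2}), ⟨u, Sf⟩ = ⟨S_K^{1/2}u, S_K^{1/2}f⟩,
so one half is completing a square (`quadForm_add_re_inner_nonneg`). Conversely, a finite infimum
gives |⟨u, Sf⟩|² ≤ C q(f). This bound passes to S_K because ker S* is orthogonal to the range of S̄,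
and resolvents of S_K then place u in D(S_K^{1/2}) (`exists_sqrt_krein_of_bound`).

Given a dissipative B ⊃ iS, take a linear complement 𝒱 of D(S) in D(B). Surjectivity of S_F
(`friedrichs_surjective`) provides ℒ with iS_F ℒ = B on 𝒱, and the same criterion puts ℒv + v, hence
v, in D(S_K^{1/2}). -/

section

open Filter Topology

namespace DissipativeExtension

/-! ### Non-negative selfadjoint operators: resolvents and square roots. -/

section Graph

variable {H : Type*} [NormedAddCommGroup H] [InnerProductSpace ℂ H]

/-- A continuous linear map that is bounded below on a closed subspace maps it to a closed
subspace. -/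
theorem isClosed_map_of_norm_le {E : Type*} [NormedAddCommGroup E] [NormedSpace ℂ E]
    [CompleteSpace E] {G : Submodule ℂ E} (hG : IsClosed (G : Set E)) (l : E →L[ℂ] H) (K : NNReal)
    (hl : ∀ p ∈ G, ‖p‖ ≤ K * ‖l p‖) : IsClosed (G.map (l : E →ₗ[ℂ] H) : Set H) := by
  have : CompleteSpace G := hG.completeSpace_coe
  have h := ((l.comp G.subtypeL).antilipschitz_of_bound (K := K) fun x => hl x x.2).isClosed_range
    (l.comp G.subtypeL).uniformContinuous
  convert h using 1
  ext y
  simp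

theorem re_inner_nonneg_of_mem_graph {T : H →ₗ.[ℂ] H}
    (hpos : ∀ x : T.domain, 0 ≤ (inner ℂ (x : H) (T x)).re) {x y : H} (h : (x, y) ∈ T.graph) :
    0 ≤ (inner ℂ x y).re := by
  obtain ⟨x, rfl, rfl⟩ := T.mem_graph_iff.1 h
  exact hpos x

theorem norm_sq_smul_add {c : ℝ} (x y : H) :
    ‖(c : ℂ) • x + y‖ ^ 2 = c ^ 2 * ‖x‖ ^ 2 + 2 * c * (inner ℂ x y).re + ‖y‖ ^ 2 := by
  rw [@norm_add_sq ℂ, norm_smul, mul_pow, inner_smul_left]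
  simp
  ring

theorem mem_kernel_iff {T : H →ₗ.[ℂ] H} {k : H} : k ∈ kernel T ↔ (k, 0) ∈ T.graph := by
  simp [kernel, LinearPMap.mem_graph_iff]

theorem mem_domRestrict_graph_iff {T : H →ₗ.[ℂ] H} {D : Submodule ℂ H} {x y : H} :
    (x, y) ∈ (T.domRestrict D).graph ↔ x ∈ D ∧ (x, y) ∈ T.graph := by
  constructor
  · intro h
    refine ⟨?_, LinearPMap.le_graph_of_le LinearPMap.domRestrict_le h⟩
    exact (LinearPMap.mem_domain_of_mem_graph h).1
  · rintro ⟨hx, h⟩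
    obtain ⟨x, rfl, rfl⟩ := T.mem_graph_iff.1 h
    rw [LinearPMap.mem_graph_iff]
    exact ⟨⟨x, hx, x.2⟩, rfl, LinearPMap.domRestrict_apply rfl⟩

theorem smul_le_smul_of_le {S C : H →ₗ.[ℂ] H} (c : ℂ) (h : S ≤ C) : c • S ≤ c • C :=
  ⟨h.1, fun x y hxy => congrArg (c • ·) (h.2 (x := x) (y := y) hxy)⟩

variable [CompleteSpace H]

theorem mem_adjoint_graph_iff {T : H →ₗ.[ℂ] H} (hT : Dense (T.domain : Set H)) {y z : H} :
    (y, z) ∈ T.adjoint.graph ↔ ∀ x : T.domain, inner ℂ (T x) y = inner ℂ (x : H) z := by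
  rw [LinearPMap.adjoint_graph_eq_graph_adjoint hT, Submodule.mem_adjoint_iff]
  simp only [sub_eq_zero]
  constructor
  · exact fun h x => h _ _ (T.mem_graph x)
  · rintro h a b hab
    obtain ⟨x, rfl, rfl⟩ := T.mem_graph_iff.1 hab
    exact h x

theorem mem_graph_iff_of_isSelfAdjoint {T : H →ₗ.[ℂ] H} (hT : IsSelfAdjoint T) {y z : H} :
    (y, z) ∈ T.graph ↔ ∀ x : T.domain, inner ℂ (T x) y = inner ℂ (x : H) z := by
  rw [← mem_adjoint_graph_iff hT.dense_domain, LinearPMap.isSelfAdjoint_def.1 hT]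

theorem inner_eq_of_mem_graph {T : H →ₗ.[ℂ] H} (hT : IsSelfAdjoint T) {x y x' y' : H}
    (h : (x, y) ∈ T.graph) (hmem : (x', y') ∈ T.graph) : inner ℂ y x' = inner ℂ x y' := by
  obtain ⟨x, rfl, rfl⟩ := T.mem_graph_iff.1 h
  exact (mem_graph_iff_of_isSelfAdjoint hT).1 hmem x

/-- A non-negative selfadjoint operator `T` has `c + T` surjective for every `c > 0`. -/
theorem exists_smul_add_eq {T : H →ₗ.[ℂ] H} (hT : IsSelfAdjoint T)
    (hpos : ∀ x : T.domain, 0 ≤ (inner ℂ (x : H) (T x)).re) {c : ℝ} (hc : 0 < c) (h : H) :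
    ∃ x y : H, (x, y) ∈ T.graph ∧ (c : ℂ) • x + y = h := by
  let l : H × H →L[ℂ] H :=
    (c : ℂ) • ContinuousLinearMap.fst ℂ H H + ContinuousLinearMap.snd ℂ H H
  have hbound : ∀ p ∈ T.graph, ‖p‖ ≤ (Real.toNNReal (max c⁻¹ 1) : ℝ) * ‖l p‖ := by
    rintro ⟨x, y⟩ hp
    have h0 := re_inner_nonneg_of_mem_graph hpos hp
    have hsq : ‖l (x, y)‖ ^ 2 = _ := norm_sq_smul_add x y
    have hx : c * ‖x‖ ≤ ‖l (x, y)‖ := by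
      refine le_of_pow_le_pow_left₀ two_ne_zero (norm_nonneg _) ?_
      rw [hsq, mul_pow]
      have := mul_nonneg hc.le h0
      nlinarith [sq_nonneg ‖y‖]
    have hy : ‖y‖ ≤ ‖l (x, y)‖ := by
      refine le_of_pow_le_pow_left₀ two_ne_zero (norm_nonneg _) ?_
      rw [hsq]
      have := mul_nonneg hc.le h0
      nlinarith [sq_nonneg (c * ‖x‖)]
    rw [Real.coe_toNNReal _ (by positivity), Prod.norm_mk, max_mul_of_nonneg _ _ (norm_nonneg _)]
    refine max_le_max ?_ (by simpa using hy)
    rwa [← div_eq_inv_mul, le_div_iff₀' hc]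
  have hcl := isClosed_map_of_norm_le hT.isClosed l _ hbound
  have : CompleteSpace (T.graph.map (l : H × H →ₗ[ℂ] H)) := hcl.completeSpace_coe
  have htop : T.graph.map (l : H × H →ₗ[ℂ] H) = ⊤ := by
    rw [← Submodule.orthogonal_eq_bot_iff, Submodule.eq_bot_iff]
    intro z hz
    -- A vector z orthogonal to the range of c + T satisfies Tz = -cz, which non-negativity of T
    -- allows only for z = 0.
    have hz' : (z, -(c : ℂ) • z) ∈ T.graph := by
      rw [mem_graph_iff_of_isSelfAdjoint hT]
      intro x
      have := (Submodule.mem_orthogonal _ _).1 hz _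
        (Submodule.mem_map_of_mem (T.mem_graph x))
      simp only [l, ContinuousLinearMap.coe_coe, add_apply,
        smul_apply, ContinuousLinearMap.coe_fst', ContinuousLinearMap.coe_snd',
        inner_add_left, inner_smul_left, Complex.conj_ofReal] at this
      rw [inner_smul_right]
      linear_combination this
    have h0 := re_inner_nonneg_of_mem_graph hpos hz'
    rw [inner_smul_right, inner_self_eq_norm_sq_to_K] at h0
    have h1 : (-(c : ℂ) * ((‖z‖ : ℝ) : ℂ) ^ 2).re = -(c * ‖z‖ ^ 2) := by
      rw [← neg_mul]
      norm_cast
    have h2 : 0 ≤ -(c * ‖z‖ ^ 2) := h1 ▸ h0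
    have h3 : ‖z‖ ^ 2 ≤ 0 := by
      by_contra! h3
      nlinarith [mul_pos hc h3]
    simpa using h3
  obtain ⟨⟨x, y⟩, hp, hxy⟩ := (htop ▸ Submodule.mem_top : h ∈ T.graph.map (l : H × H →ₗ[ℂ] H))
  exact ⟨x, y, hp, hxy⟩

/-- The resolvent `(1 + T)⁻¹` of a non-negative selfadjoint operator `T`. -/
theorem exists_resolvent {T : H →ₗ.[ℂ] H} (hT : IsSelfAdjoint T)
    (hpos : ∀ x : T.domain, 0 ≤ (inner ℂ (x : H) (T x)).re) :
    ∃ B : H →L[ℂ] H, 0 ≤ B ∧ 0 ≤ 1 - B ∧ ∀ x y, (x, y) ∈ T.graph ↔ B (x + y) = x := by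
  have hle : ∀ x y : H, (x, y) ∈ T.graph → ‖x‖ ≤ ‖x + y‖ := by
    intro x y hxy
    have h0 := re_inner_nonneg_of_mem_graph hpos hxy
    have h1 := norm_sq_smul_add (c := 1) x y
    rw [Complex.ofReal_one, one_smul] at h1
    refine le_of_pow_le_pow_left₀ two_ne_zero (norm_nonneg _) ?_
    nlinarith [sq_nonneg ‖y‖]
  have huniq : ∀ h x : H, (x, h - x) ∈ T.graph → ∀ x', (x', h - x') ∈ T.graph → x = x' := by
    intro h x hx x' hx'
    have := hle _ _ (T.graph.sub_mem hx hx')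
    rw [← sub_eq_zero, ← norm_le_zero_iff]
    simpa using this
  have hex : ∀ h : H, ∃ x, (x, h - x) ∈ T.graph := by
    intro h
    obtain ⟨x, y, hxy, rfl⟩ := exists_smul_add_eq hT hpos one_pos h
    exact ⟨x, by simpa using hxy⟩
  choose b hb using hex
  let B : H →L[ℂ] H := LinearMap.mkContinuous
    { toFun := b
      map_add' := fun h h' => huniq _ _ (hb _) _ <| by
        convert T.graph.add_mem (hb h) (hb h') using 1
        simp [add_sub_add_comm]
      map_smul' := fun c h => huniq _ _ (hb _) _ <| by
        convert T.graph.smul_mem c (hb h) using 1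
        simp [smul_sub] } 1 fun h => by simpa using hle _ _ (hb h)
  have hB : ∀ h, (B h, h - B h) ∈ T.graph := hb
  have hsymm : ∀ x y, inner ℂ (B x) y = inner ℂ x (B y) := by
    intro x y
    have := inner_eq_of_mem_graph hT (hB x) (hB y)
    rw [inner_sub_left, inner_sub_right] at this
    linear_combination -this
  have hre : ∀ x, 0 ≤ (inner ℂ (B x) (x - B x)).re :=
    fun x => re_inner_nonneg_of_mem_graph hpos (hB x)
  have hnn : ∀ z : H, 0 ≤ (inner ℂ z z).re := fun z => by
    simpa using inner_self_nonneg (𝕜 := ℂ) (x := z)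
  refine ⟨B, ?_, ?_, fun x y => ⟨fun h => ?_, fun h => ?_⟩⟩
  · rw [ContinuousLinearMap.nonneg_iff_isPositive]
    refine ⟨hsymm, fun x => ?_⟩
    have h1 := hre x
    rw [inner_sub_right, Complex.sub_re] at h1
    exact (by linarith [hnn (B x)] : 0 ≤ (inner ℂ (B x) x).re)
  · rw [ContinuousLinearMap.nonneg_iff_isPositive]
    refine ⟨fun x y => ?_, fun x => ?_⟩
    · have := hsymm x y
      simp only [ContinuousLinearMap.coe_coe, sub_apply,
        one_apply_eq_self, inner_sub_left, inner_sub_right, this]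
    · have h1 : inner ℂ (x - B x) x = inner ℂ (x - B x) (x - B x) + inner ℂ (x - B x) (B x) := by
        rw [← inner_add_right, sub_add_cancel]
      have h2 : (inner ℂ (x - B x) (B x)).re = (inner ℂ (B x) (x - B x)).re := by
        rw [← inner_conj_symm, Complex.conj_re]
      have h3 : 0 ≤ (inner ℂ (x - B x) x).re := by
        rw [h1, Complex.add_re, h2]
        exact add_nonneg (hnn _) (hre x)
      exact h3
  · exact huniq (x + y) _ (hB _) _ (by simpa using h)
  · have := hB (x + y)
    rw [h] at this
    simpa using this

/-- Every non-negative selfadjoint operator has a non-negative selfadjoint square root. -/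
theorem exists_isNonnegSqrt {T : H →ₗ.[ℂ] H} (hT : IsSelfAdjoint T)
    (hpos : ∀ x : T.domain, 0 ≤ (inner ℂ (x : H) (T x)).re) : ∃ R, IsNonnegSqrt T R := by
  obtain ⟨B, hB0, hB1, hB⟩ := exists_resolvent hT hpos
  set a : H →L[ℂ] H := CFC.sqrt B
  set b : H →L[ℂ] H := CFC.sqrt (1 - B)
  have ha : a * a = B := CFC.sqrt_mul_sqrt_self B
  have hb : b * b = 1 - B := CFC.sqrt_mul_sqrt_self (1 - B)
  have hab : Commute a b := by
    have h1 : Commute B (1 - B) := (Commute.one_right B).sub_right (Commute.refl B)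
    exact ((h1.cfcₙ_nnreal _).symm.cfcₙ_nnreal _).symm
  have ha0 : a.IsPositive := (ContinuousLinearMap.nonneg_iff_isPositive a).1 (CFC.sqrt_nonneg _)
  have hb0 : b.IsPositive := (ContinuousLinearMap.nonneg_iff_isPositive b).1 (CFC.sqrt_nonneg _)
  have hab0 : (a * b).IsPositive := (ContinuousLinearMap.nonneg_iff_isPositive _).1
    (hab.mul_nonneg (CFC.sqrt_nonneg _) (CFC.sqrt_nonneg _))
  have haa : ∀ x, a (a x) = B x := fun x => DFunLike.congr_fun ha x
  have hbb : ∀ x, b (b x) = x - B x := fun x => DFunLike.congr_fun hb x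
  have hba : ∀ x, b (a x) = a (b x) := fun x => DFunLike.congr_fun hab.eq.symm x
  have hainj : ∀ x, a x = 0 → x = 0 := by
    intro x hx
    have h1 : (0, x) ∈ T.graph := by rw [hB, zero_add, ← haa, hx, map_zero]
    exact T.graph_fst_eq_zero_snd h1 rfl
  -- Formally T = (1 - B)B⁻¹, so its root is b a⁻¹; parametrising the graph as t ↦ (a t, b t) avoids
  -- the unbounded inverse.
  let G : Submodule ℂ (H × H) := LinearMap.range ((a : H →ₗ[ℂ] H).prod (b : H →ₗ[ℂ] H))
  have hG : ∀ x y, (x, y) ∈ G ↔ ∃ t, a t = x ∧ b t = y := by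
    intro x y
    simp [G, LinearMap.mem_range]
  have hgraph : G.toLinearPMap.graph = G := by
    refine Submodule.toLinearPMap_graph_eq _ ?_
    rintro ⟨x, y⟩ hxy (rfl : x = 0)
    obtain ⟨t, ht, rfl⟩ := (hG _ _).1 hxy
    simp [hainj t ht]
  set R := G.toLinearPMap
  have hRg : ∀ x y, (x, y) ∈ R.graph ↔ ∃ t, a t = x ∧ b t = y := by
    intro x y
    rw [hgraph, hG]
  have hcrit : ∀ y z, a z = b y → ∃ t, a t = y ∧ b t = z := by
    intro y z h
    -- The witness comes from a² + b² = 1, with a and b commuting: (a, b) is an isometry onto the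
    -- graph, and this is its adjoint.
    refine ⟨a y + b z, ?_, ?_⟩
    · rw [map_add, haa, ← hba, h, hbb, add_sub_cancel]
    · rw [map_add, hba, ← h, haa, hbb, add_sub_cancel]
  have hdense : Dense (R.domain : Set H) := by
    rw [Submodule.dense_iff_topologicalClosure_eq_top,
      Submodule.topologicalClosure_eq_top_iff, Submodule.eq_bot_iff]
    intro z hz
    refine hainj z ?_
    have h1 : a (a z) ∈ R.domain :=
      LinearPMap.mem_domain_of_mem_graph ((hRg (a (a z)) (b (a z))).2 ⟨_, rfl, rfl⟩)
    have h2 := (Submodule.mem_orthogonal _ _).1 hz _ h1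
    rw [ha0.inner_left_eq_inner_right] at h2
    exact inner_self_eq_zero.1 h2
  have hmem : ∀ y z, (y, z) ∈ R.adjoint.graph ↔ (y, z) ∈ R.graph := by
    intro y z
    rw [mem_adjoint_graph_iff hdense, hRg]
    constructor
    · intro h
      refine hcrit _ _ ?_
      refine ext_inner_left ℂ fun t => ?_
      have h1 : (a t, b t) ∈ R.graph := (hRg _ _).2 ⟨t, rfl, rfl⟩
      obtain ⟨x, hx, hx'⟩ := R.mem_graph_iff.1 h1
      have h2 := h x
      rw [hx', hx] at h2
      rw [← ha0.inner_left_eq_inner_right, ← hb0.inner_left_eq_inner_right]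
      exact h2.symm
    · rintro ⟨t, rfl, rfl⟩ x
      obtain ⟨s, hs, hs'⟩ := (hRg _ _).1 (R.mem_graph x)
      rw [← hs, ← hs', hb0.inner_left_eq_inner_right, hba, ha0.inner_left_eq_inner_right]
  refine ⟨R, ?_, ?_, ?_⟩
  · rw [LinearPMap.isSelfAdjoint_def]
    refine LinearPMap.eq_of_eq_graph ?_
    ext ⟨y, z⟩
    exact hmem y z
  · intro x
    obtain ⟨s, hs, hs'⟩ := (hRg _ _).1 (R.mem_graph x)
    rw [← hs, ← hs', ha0.inner_left_eq_inner_right]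
    exact hab0.re_inner_nonneg_right s
  · intro x y
    constructor
    · intro h
      have h1 := (hB x y).1 h
      refine ⟨b (a (x + y)), (hRg _ _).2 ⟨a (x + y), ?_, rfl⟩,
        (hRg _ _).2 ⟨b (x + y), (hba _).symm, ?_⟩⟩
      · rw [haa, h1]
      · rw [hbb, h1, add_sub_cancel_left]
    · rintro ⟨z, h1, h2⟩
      obtain ⟨s, rfl, rfl⟩ := (hRg _ _).1 h1
      obtain ⟨t, ht, rfl⟩ := (hRg _ _).1 h2
      rw [hB, map_add, ← haa, ← haa, haa s, ← hba, ht, hbb, ← map_add, add_sub_cancel]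

end Graph

/-! ### The Kreĭn–von Neumann extension is selfadjoint and non-negative. -/

section Krein

variable {H : Type*} [NormedAddCommGroup H] [InnerProductSpace ℂ H] [CompleteSpace H]
  {S : H →ₗ.[ℂ] H}

theorem IsStrictlyPositiveSymmetric.le_adjoint (hS : IsStrictlyPositiveSymmetric S) :
    S ≤ S.adjoint :=
  hS.symmetric.le_adjoint hS.dense

theorem IsStrictlyPositiveSymmetric.isClosable (hS : IsStrictlyPositiveSymmetric S) :
    S.IsClosable :=
  (LinearPMap.adjoint_isClosed hS.dense).isClosable.leIsClosable hS.le_adjoint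

theorem IsStrictlyPositiveSymmetric.closure_le_adjoint (hS : IsStrictlyPositiveSymmetric S) :
    S.closure.graph ≤ S.adjoint.graph := by
  rw [← hS.isClosable.graph_closure_eq_closure_graph]
  exact Submodule.topologicalClosure_minimal _ (LinearPMap.le_graph_of_le hS.le_adjoint)
    (LinearPMap.adjoint_isClosed hS.dense)

/-- A closed condition that holds on the graph of `S` holds on the graph of its closure. -/
theorem IsStrictlyPositiveSymmetric.closure_induction (hS : IsStrictlyPositiveSymmetric S)
    {p : H × H → Prop} (hp : IsClosed {z | p z}) (h : ∀ f : S.domain, p (f, S f)) {g z : H}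
    (hgz : (g, z) ∈ S.closure.graph) : p (g, z) := by
  rw [← hS.isClosable.graph_closure_eq_closure_graph] at hgz
  refine closure_minimal (t := {z | p z}) ?_ hp hgz
  rintro ⟨x, y⟩ hxy
  obtain ⟨f, rfl, rfl⟩ := S.mem_graph_iff.1 hxy
  exact h f

theorem mem_krein_graph_iff (hS : IsStrictlyPositiveSymmetric S) {x y : H} :
    (x, y) ∈ (krein S).graph ↔
      ∃ g k, (g, y) ∈ S.closure.graph ∧ (k, 0) ∈ S.adjoint.graph ∧ g + k = x := by
  rw [krein, mem_domRestrict_graph_iff, Submodule.mem_sup]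
  constructor
  · rintro ⟨⟨g, hg, k, hk, rfl⟩, h⟩
    obtain ⟨z, hz⟩ := LinearPMap.mem_domain_iff.1 hg
    rw [mem_kernel_iff] at hk
    have h1 := S.adjoint.graph.add_mem (hS.closure_le_adjoint hz) hk
    have h2 : z = y := by
      simpa using S.adjoint.mem_graph_snd_inj h1 h (by simp)
    exact ⟨g, k, h2 ▸ hz, hk, rfl⟩
  · rintro ⟨g, k, hg, hk, rfl⟩
    refine ⟨⟨g, LinearPMap.mem_domain_of_mem_graph hg, k, mem_kernel_iff.2 hk, rfl⟩, ?_⟩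
    simpa using S.adjoint.graph.add_mem (hS.closure_le_adjoint hg) hk

theorem le_krein (hS : IsStrictlyPositiveSymmetric S) : S ≤ krein S := by
  refine LinearPMap.le_of_le_graph ?_
  rintro ⟨x, y⟩ h
  exact (mem_krein_graph_iff hS).2
    ⟨x, 0, LinearPMap.le_graph_of_le S.le_closure h, Submodule.zero_mem _, add_zero _⟩

theorem inner_of_mem_adjoint_kernel (hS : IsStrictlyPositiveSymmetric S) {g z k : H}
    (hg : (g, z) ∈ S.closure.graph) (hk : (k, 0) ∈ S.adjoint.graph) : inner ℂ z k = 0 := by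
  refine hS.closure_induction (p := fun q => inner ℂ q.2 k = 0) ?_ (fun f => ?_) hg
  · exact isClosed_eq (by fun_prop) continuous_const
  · rw [(mem_adjoint_graph_iff hS.dense).1 hk f, inner_zero_right]

theorem inner_symm_of_mem_closure (hS : IsStrictlyPositiveSymmetric S) {g z g' z' : H}
    (hg : (g, z) ∈ S.closure.graph) (hmem : (g', z') ∈ S.closure.graph) :
    inner ℂ z g' = inner ℂ g z' := by
  refine hS.closure_induction (p := fun q => inner ℂ q.2 g' = inner ℂ q.1 z') ?_ (fun f => ?_) hg
  · exact isClosed_eq (by fun_prop) (by fun_prop)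
  · exact (mem_adjoint_graph_iff hS.dense).1 (hS.closure_le_adjoint hmem) f

/-- The range of the closure of `S` is the orthogonal complement of the kernel of `S*`. -/
theorem exists_mem_closure_graph (hS : IsStrictlyPositiveSymmetric S) {z : H}
    (hz : ∀ k, (k, 0) ∈ S.adjoint.graph → inner ℂ k z = 0) :
    ∃ g, (g, z) ∈ S.closure.graph := by
  obtain ⟨ε, hε, hpos⟩ := hS.strictly_positive
  -- Strict positivity survives in the closure and gives ε‖g‖ ≤ ‖S̄g‖, so the range of S̄ is closed
  -- and equals its double orthogonal complement.
  have hbound : ∀ p ∈ S.closure.graph,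
      ‖p‖ ≤ (Real.toNNReal (max ε⁻¹ 1) : ℝ) * ‖ContinuousLinearMap.snd ℂ H H p‖ := by
    rintro ⟨g, y⟩ hp
    have h1 : ε * ‖g‖ ^ 2 ≤ (inner ℂ g y).re := by
      refine hS.closure_induction (p := fun q => ε * ‖q.1‖ ^ 2 ≤ (inner ℂ q.1 q.2).re) ?_
        hpos hp
      exact isClosed_le (by fun_prop) (Complex.continuous_re.comp (by fun_prop))
    have h2 : ε * ‖g‖ ≤ ‖y‖ := by
      have h3 : (inner ℂ g y).re ≤ ‖g‖ * ‖y‖ :=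
        (Complex.re_le_norm _).trans (norm_inner_le_norm _ _)
      rcases (norm_nonneg g).eq_or_lt with h0 | h0
      · rw [← h0]; simp
      · nlinarith
    rw [Real.coe_toNNReal _ (by positivity), Prod.norm_mk, max_mul_of_nonneg _ _ (norm_nonneg _)]
    refine max_le_max ?_ (by simp)
    rwa [← div_eq_inv_mul, le_div_iff₀' hε]
  have hcl := isClosed_map_of_norm_le hS.isClosable.closure_isClosed _ _ hbound
  set M := S.closure.graph.map (ContinuousLinearMap.snd ℂ H H : H × H →ₗ[ℂ] H)
  have : CompleteSpace M := hcl.completeSpace_coe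
  have hM : z ∈ M := by
    rw [← Submodule.orthogonal_orthogonal M, Submodule.mem_orthogonal]
    intro k hk
    refine hz k ((mem_adjoint_graph_iff hS.dense).2 fun f => ?_)
    rw [inner_zero_right]
    exact (Submodule.mem_orthogonal _ _).1 hk _ (Submodule.mem_map_of_mem
      (LinearPMap.le_graph_of_le S.le_closure (S.mem_graph f)))
  obtain ⟨⟨g, y⟩, hp, rfl⟩ := hM
  exact ⟨g, hp⟩

theorem krein_dense (hS : IsStrictlyPositiveSymmetric S) :
    Dense ((krein S).domain : Set H) :=
  hS.dense.mono (le_krein hS).1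

/-- Let z = S_K* y. Testing against D(S) gives z = S*y, and testing against ker S* gives z ⟂ ker S*.
Hence z = S̄g for some g, and y - g ∈ ker S*. Symmetry follows from the orthogonality of ran S̄ and
ker S*. -/
theorem isSelfAdjoint_krein (hS : IsStrictlyPositiveSymmetric S) : IsSelfAdjoint (krein S) := by
  rw [LinearPMap.isSelfAdjoint_def]
  refine LinearPMap.eq_of_eq_graph ?_
  ext ⟨y, z⟩
  constructor
  · intro h
    have hinner : ∀ x x', (x, x') ∈ (krein S).graph → inner ℂ x' y = inner ℂ x z := by
      intro x x' hx
      obtain ⟨x, rfl, rfl⟩ := (krein S).mem_graph_iff.1 hx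
      exact (mem_adjoint_graph_iff (krein_dense hS)).1 h x
    have hyz : (y, z) ∈ S.adjoint.graph := (mem_adjoint_graph_iff hS.dense).2 fun f =>
      hinner _ _ (LinearPMap.le_graph_of_le (le_krein hS) (S.mem_graph f))
    obtain ⟨g, hg⟩ := exists_mem_closure_graph hS (z := z) fun k hk => by
      rw [← hinner k 0 ((mem_krein_graph_iff hS).2 ⟨0, k, Submodule.zero_mem _, hk, zero_add _⟩),
        inner_zero_left]
    refine (mem_krein_graph_iff hS).2 ⟨g, y - g, hg, ?_, by abel⟩
    simpa using S.adjoint.graph.sub_mem hyz (hS.closure_le_adjoint hg)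
  · intro h
    rw [mem_adjoint_graph_iff (krein_dense hS)]
    intro x
    obtain ⟨g, k, hg, hk, hx⟩ := (mem_krein_graph_iff hS).1 ((krein S).mem_graph x)
    obtain ⟨g', k', hg', hk', rfl⟩ := (mem_krein_graph_iff hS).1 h
    rw [← hx, inner_add_left, inner_add_right, inner_of_mem_adjoint_kernel hS hg hk',
      inner_symm_of_mem_closure hS hg hg', ← inner_conj_symm k,
      inner_of_mem_adjoint_kernel hS hg' hk, map_zero]

theorem krein_nonneg (hS : IsStrictlyPositiveSymmetric S) (x : (krein S).domain) :
    0 ≤ (inner ℂ (x : H) (krein S x)).re := by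
  obtain ⟨g, k, hg, hk, hx⟩ := (mem_krein_graph_iff hS).1 ((krein S).mem_graph x)
  rw [← hx, inner_add_left, ← inner_conj_symm k, inner_of_mem_adjoint_kernel hS hg hk, map_zero,
    add_zero]
  refine hS.closure_induction (p := fun q => 0 ≤ (inner ℂ q.1 q.2).re) ?_
    hS.quadForm_nonneg hg
  exact isClosed_le continuous_const (Complex.continuous_re.comp (by fun_prop))

theorem isNonnegSqrt_sqrt_krein (hS : IsStrictlyPositiveSymmetric S) :
    IsNonnegSqrt (krein S) (sqrt (krein S)) := by
  have h := exists_isNonnegSqrt (isSelfAdjoint_krein hS) (krein_nonneg hS)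
  rw [sqrt, dif_pos h]
  exact h.choose_spec

end Krein

/-! ### Membership in the domain of S_K^{1/2}. -/

section FormDomain

variable {H : Type*} [NormedAddCommGroup H] [InnerProductSpace ℂ H] [CompleteSpace H]
  {S R : H →ₗ.[ℂ] H}

theorem IsNonnegSqrt.norm_sq_eq {T : H →ₗ.[ℂ] H} (hR : IsNonnegSqrt T R) {x y z : H}
    (hxz : (x, z) ∈ R.graph) (hzy : (z, y) ∈ R.graph) : ‖z‖ ^ 2 = (inner ℂ x y).re := by
  rw [← inner_eq_of_mem_graph hR.selfAdjoint hxz hzy, inner_self_eq_norm_sq_to_K]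
  norm_cast

/-- `S_K^{1/2}` maps `D(S)` isometrically for the form of `S`. -/
theorem exists_sqrt_apply (hS : IsStrictlyPositiveSymmetric S) (hR : IsNonnegSqrt (krein S) R)
    (f : S.domain) :
    ∃ r, ((f : H), r) ∈ R.graph ∧ (r, S f) ∈ R.graph ∧ ‖r‖ ^ 2 = quadForm S f := by
  obtain ⟨r, h1, h2⟩ := (hR.sq_eq _ _).1
    (LinearPMap.le_graph_of_le (le_krein hS) (S.mem_graph f))
  exact ⟨r, h1, h2, hR.norm_sq_eq h1 h2⟩

/-- A bound for `⟨u, S f⟩` by the form of `S` extends from `S` to `S_K`. -/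
theorem norm_inner_krein_sq_le (hS : IsStrictlyPositiveSymmetric S) {u : H} {C : ℝ}
    (hu : ∀ f : S.domain, ‖inner ℂ u (S f)‖ ^ 2 ≤ C * quadForm S f) {x y : H}
    (hxy : (x, y) ∈ (krein S).graph) : ‖inner ℂ u y‖ ^ 2 ≤ C * (inner ℂ x y).re := by
  obtain ⟨g, k, hg, hk, rfl⟩ := (mem_krein_graph_iff hS).1 hxy
  -- The component k in ker S* drops out of ⟨x, y⟩, so only the bound on the closure of S remains.
  rw [inner_add_left, ← inner_conj_symm k, inner_of_mem_adjoint_kernel hS hg hk, map_zero,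
    add_zero]
  refine hS.closure_induction
    (p := fun q => ‖inner ℂ u q.2‖ ^ 2 ≤ C * (inner ℂ q.1 q.2).re) ?_ hu hg
  exact isClosed_le (by fun_prop)
    (continuous_const.mul (Complex.continuous_re.comp (by fun_prop)))

/-- If `u` is a limit of vectors `x n ∈ D(R)` with `R (x n)` bounded, then `u ∈ D(R)`, with the
same bound. -/
theorem exists_mem_graph_of_tendsto (hR : IsSelfAdjoint R) {x r : ℕ → H} {u : H} {K : ℝ}
    (hxr : ∀ n, (x n, r n) ∈ R.graph) (hr : ∀ n, ‖r n‖ ≤ K)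
    (hx : Tendsto x atTop (𝓝 u)) : ∃ w, (u, w) ∈ R.graph ∧ ‖w‖ ≤ K := by
  -- Boundedness of y ↦ ⟨u, Ry⟩ means u ∈ D(R*) = D(R).
  have hbound : ∀ y : R.domain, ‖inner ℂ u (R y)‖ ≤ K * ‖(y : H)‖ := by
    intro y
    have hlim : Tendsto (fun n => ‖inner ℂ (x n) (R y)‖) atTop (𝓝 ‖inner ℂ u (R y)‖) :=
      (hx.inner tendsto_const_nhds).norm
    refine le_of_tendsto' hlim fun n => ?_
    rw [← inner_eq_of_mem_graph hR (hxr n) (R.mem_graph y)]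
    exact (norm_inner_le_norm _ _).trans (mul_le_mul_of_nonneg_right (hr n) (norm_nonneg _))
  have hu : u ∈ R.domain := by
    rw [← LinearPMap.isSelfAdjoint_def.1 hR, LinearPMap.mem_adjoint_domain_iff]
    exact AddMonoidHomClass.continuous_of_bound ((innerₛₗ ℂ u).comp R.toFun) K hbound
  refine ⟨R ⟨u, hu⟩, R.mem_graph ⟨u, hu⟩, ?_⟩
  have hball : ∀ y : H, ‖inner ℂ (R ⟨u, hu⟩) y‖ ≤ K * ‖y‖ := by
    intro y
    refine hR.dense_domain.induction (P := fun y => ‖inner ℂ (R ⟨u, hu⟩) y‖ ≤ K * ‖y‖)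
      (fun y hy => ?_) (isClosed_le (by fun_prop) (by fun_prop)) y
    rw [inner_eq_of_mem_graph hR (R.mem_graph _) (R.mem_graph ⟨y, hy⟩)]
    exact hbound ⟨y, hy⟩
  have h := hball (R ⟨u, hu⟩)
  rw [inner_self_eq_norm_sq_to_K, norm_pow, RCLike.norm_ofReal, abs_norm, sq] at h
  rcases (norm_nonneg (R ⟨u, hu⟩)).eq_or_lt with h0 | h0
  · exact h0 ▸ (norm_nonneg _).trans (hr 0)
  · exact le_of_mul_le_mul_right h h0

end FormDomain

/-! ### The variational formula for ‖S_K^{1/2}u‖², and surjectivity of S_F. -/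

section FormBound

variable {H : Type*} [NormedAddCommGroup H] [InnerProductSpace ℂ H] [CompleteSpace H]
  {S R : H →ₗ.[ℂ] H}

/-- If `|⟨u, S f⟩|² ≤ C ⟨f, S f⟩` on `D(S)`, then `u ∈ D(S_K^{1/2})` and
`‖S_K^{1/2} u‖² ≤ C`. -/
theorem exists_sqrt_krein_of_bound (hS : IsStrictlyPositiveSymmetric S)
    (hR : IsNonnegSqrt (krein S) R) {u : H} {C : ℝ} (hC : 0 ≤ C)
    (hu : ∀ f : S.domain, ‖inner ℂ u (S f)‖ ^ 2 ≤ C * quadForm S f) :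
    ∃ w, (u, w) ∈ R.graph ∧ ‖w‖ ^ 2 ≤ C := by
  have happrox : ∀ n : ℕ, ∃ x r, (x, r) ∈ R.graph ∧ ‖r‖ ^ 2 ≤ C ∧
      ‖u - x‖ ^ 2 ≤ C * (1 / ((n : ℝ) + 1)) := by
    intro n
    have hn : (0 : ℝ) < n + 1 := by positivity
    set c : ℝ := n + 1
    -- Here x = c(c + S_K)⁻¹u with c = n + 1, an approximation of u inside D(S_K) with S_K x = c(u -
    -- x).
    obtain ⟨x, y, hxy, hsum⟩ :=
      exists_smul_add_eq (isSelfAdjoint_krein hS) (krein_nonneg hS) hn ((c : ℂ) • u)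
    obtain ⟨r, hxr, hry⟩ := (hR.sq_eq _ _).1 hxy
    have hr := hR.norm_sq_eq hxr hry
    have hy : y = (c : ℂ) • (u - x) := by
      rw [smul_sub, ← hsum, add_sub_cancel_left]
    have huy : (inner ℂ u y).re = ‖r‖ ^ 2 + c * ‖u - x‖ ^ 2 := by
      have h1 : inner ℂ u y = inner ℂ x y + inner ℂ (u - x) y := by
        rw [← inner_add_left, add_sub_cancel]
      have h2 : (inner ℂ (u - x) y).re = c * ‖u - x‖ ^ 2 := by
        rw [hy, inner_smul_right, Complex.re_ofReal_mul]
        exact congrArg (c * ·) (inner_self_eq_norm_sq (𝕜 := ℂ) (u - x))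
      rw [h1, Complex.add_re, h2, hr]
    have hle : (‖r‖ ^ 2 + c * ‖u - x‖ ^ 2) ^ 2 ≤ C * ‖r‖ ^ 2 := by
      have h1 := norm_inner_krein_sq_le hS hu hxy
      rw [← hr] at h1
      refine le_trans ?_ h1
      rw [← huy]
      exact sq_le_sq' (neg_le_of_abs_le (Complex.abs_re_le_norm _)) (Complex.re_le_norm _)
    have hd : 0 ≤ c * ‖u - x‖ ^ 2 := by positivity
    have hr0 : 0 ≤ ‖r‖ ^ 2 := by positivity
    -- With s = ‖r‖² and d = c‖u - x‖², the bound reads (s + d)² ≤ Cs ≤ C(s + d).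
    have hsum_le : ‖r‖ ^ 2 + c * ‖u - x‖ ^ 2 ≤ C := by
      by_contra! h
      nlinarith
    refine ⟨x, r, hxr, by linarith, ?_⟩
    rw [mul_one_div, le_div_iff₀' hn]
    linarith
  choose x r hxr hr hux using happrox
  have hx : Tendsto x atTop (𝓝 u) := by
    rw [tendsto_iff_norm_sub_tendsto_zero]
    have h1 : Tendsto (fun n => ‖u - x n‖ ^ 2) atTop (𝓝 0) := by
      refine squeeze_zero (fun n => by positivity) hux ?_
      simpa using (tendsto_one_div_add_atTop_nhds_zero_nat (𝕜 := ℝ)).const_mul C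
    have h2 := (Real.continuous_sqrt.tendsto 0).comp h1
    rw [Real.sqrt_zero] at h2
    refine h2.congr fun n => ?_
    simp [norm_sub_rev]
  obtain ⟨w, hw, hwC⟩ := exists_mem_graph_of_tendsto hR.selfAdjoint hxr
    (fun n => Real.le_sqrt_of_sq_le (hr n)) hx
  exact ⟨w, hw, (Real.le_sqrt (norm_nonneg _) hC).1 hwC⟩

/-- The infimum of `⟨f, S f⟩ + Re ⟨u, S f⟩` over `D(S)` is `-¼ ‖S_K^{1/2} u‖²`: lower bound. -/
theorem quadForm_add_re_inner_nonneg (hS : IsStrictlyPositiveSymmetric S)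
    (hR : IsNonnegSqrt (krein S) R) {u w : H} (hw : (u, w) ∈ R.graph) {c : ℝ}
    (hc : 1 / 4 * ‖w‖ ^ 2 ≤ c) (f : S.domain) :
    0 ≤ quadForm S f + c + (inner ℂ u (S f)).re := by
  obtain ⟨r, -, hrS, hr⟩ := exists_sqrt_apply hS hR f
  rw [← inner_eq_of_mem_graph hR.selfAdjoint hw hrS, ← hr]
  have h1 : -(‖w‖ * ‖r‖) ≤ (inner ℂ w r).re :=
    neg_le_of_abs_le ((Complex.abs_re_le_norm _).trans (norm_inner_le_norm _ _))
  nlinarith [sq_nonneg (‖w‖ / 2 - ‖r‖)]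

/-- The infimum of `⟨f, S f⟩ + Re ⟨u, S f⟩` over `D(S)` is finite only if
`u ∈ D(S_K^{1/2})`, and then at most `-¼ ‖S_K^{1/2} u‖²`. -/
theorem exists_sqrt_krein_of_quadForm_add_nonneg (hS : IsStrictlyPositiveSymmetric S)
    (hR : IsNonnegSqrt (krein S) R) {u : H} {c : ℝ}
    (h : ∀ f : S.domain, 0 ≤ quadForm S f + c + (inner ℂ u (S f)).re) :
    ∃ w, (u, w) ∈ R.graph ∧ 1 / 4 * ‖w‖ ^ 2 ≤ c := by
  have hc : 0 ≤ c := by simpa [quadForm] using h 0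
  obtain ⟨w, hw, hwc⟩ := exists_sqrt_krein_of_bound hS hR (u := u) (C := 4 * c)
      (by positivity) <| by
    intro f
    set s := inner ℂ u (S f) with hs
    -- Replacing f by t s̄ f makes the linear term the real number t|s|². The discriminant then
    -- yields |s|⁴ ≤ 4c|s|² q(f), whence the constant 4c.
    have hquad : ∀ t : ℝ, 0 ≤ ‖s‖ ^ 2 * quadForm S f * (t * t) + ‖s‖ ^ 2 * t + c := by
      intro t
      have h1 := h (((t : ℂ) * starRingEnd ℂ s) • f)
      rw [quadForm_smul, LinearPMap.map_smul, inner_smul_right, ← hs, mul_assoc,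
        Complex.conj_mul', norm_mul, Complex.norm_real, RCLike.norm_conj, mul_pow,
        Real.norm_eq_abs, sq_abs] at h1
      have h2 : ((t : ℂ) * (‖s‖ : ℂ) ^ 2).re = t * ‖s‖ ^ 2 := by norm_cast
      rw [h2] at h1
      linarith
    have hd := discrim_le_zero hquad
    rw [discrim] at hd
    rcases (norm_nonneg s).eq_or_lt with h0 | h0
    · rw [← h0]
      simpa using mul_nonneg (mul_nonneg zero_le_four hc) (hS.quadForm_nonneg f)
    · have h1 : 0 < ‖s‖ ^ 2 := by positivity
      refine le_of_mul_le_mul_left ?_ h1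
      linarith
  exact ⟨w, hw, by linarith⟩

/-- The domain of the closed form of `S` is contained in `D(S_K^{1/2})`. -/
theorem closedFormDomain_le (hS : IsStrictlyPositiveSymmetric S)
    (hR : IsNonnegSqrt (krein S) R) : closedFormDomain hS ≤ R.domain := by
  rintro w ⟨u, hu, hu'⟩
  choose r hr hrS hrn using fun f => exists_sqrt_apply hS hR f
  have hsub : ∀ f g, r f - r g = r (f - g) := fun f g =>
    R.mem_graph_snd_inj (R.graph.sub_mem (hr f) (hr g)) (hr (f - g)) rfl
  have hcauchy : CauchySeq fun n => r (u n) := by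
    rw [cauchySeq_iff_tendsto_dist_atTop_0]
    have h2 := (Real.continuous_sqrt.tendsto 0).comp hu'
    rw [Real.sqrt_zero] at h2
    refine h2.congr fun p => ?_
    rw [dist_eq_norm, hsub, Function.comp_apply, ← hrn, Real.sqrt_sq (norm_nonneg _)]
  obtain ⟨ξ, hξ⟩ := cauchySeq_tendsto_of_complete hcauchy
  have hmem : (w, ξ) ∈ R.graph := hR.selfAdjoint.isClosed.mem_of_tendsto
    (hu.prodMk_nhds hξ) (Eventually.of_forall fun n => hr (u n))
  exact LinearPMap.mem_domain_of_mem_graph hmem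

theorem friedrichs_domain_le (hS : IsStrictlyPositiveSymmetric S)
    (hR : IsNonnegSqrt (krein S) R) : (friedrichs hS).domain ≤ R.domain :=
  inf_le_left.trans (closedFormDomain_le hS hR)

theorem inner_friedrichs (hS : IsStrictlyPositiveSymmetric S) (f : S.domain)
    (w : (friedrichs hS).domain) :
    inner ℂ (f : H) (friedrichs hS w) = inner ℂ (S f) (w : H) :=
  ((mem_adjoint_graph_iff hS.dense).1
    (LinearPMap.le_graph_of_le LinearPMap.domRestrict_le ((friedrichs hS).mem_graph w)) f).symm

/-- The Friedrichs extension is surjective. -/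
theorem friedrichs_surjective (hS : IsStrictlyPositiveSymmetric S) :
    Function.Surjective (friedrichs hS) := by
  intro h
  obtain ⟨ε, hε, hpos⟩ := hS.strictly_positive
  have hR := isNonnegSqrt_sqrt_krein hS
  set R := sqrt (krein S)
  choose r hr hrS hrn using fun f => exists_sqrt_apply hS hR f
  have huniq : ∀ (f : S.domain) x, ((f : H), x) ∈ R.graph → r f = x :=
    fun f x hx => R.mem_graph_snd_inj (hr f) hx rfl
  -- ρ is S_K^{1/2} on D(S), isometric for the form; the closure of its range models the form
  -- completion of D(S).
  let ρ : S.domain →ₗ[ℂ] H :=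
    { toFun := r
      map_add' := fun f g => huniq _ _ (R.graph.add_mem (hr f) (hr g))
      map_smul' := fun c f => huniq _ _ (R.graph.smul_mem c (hr f)) }
  have hρ : ∀ f, r f = ρ f := fun _ => rfl
  simp only [hρ] at hr hrS hrn
  have hbound : ∀ f : S.domain, ‖(f : H)‖ ≤ (√ε)⁻¹ * ‖ρ f‖ := by
    intro f
    rw [← div_eq_inv_mul, le_div_iff₀' (Real.sqrt_pos.2 hε)]
    refine le_of_pow_le_pow_left₀ two_ne_zero (norm_nonneg _) ?_
    rw [mul_pow, Real.sq_sqrt hε.le, hrn]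
    exact hpos f
  have hinj : Function.Injective ρ := by
    rw [injective_iff_map_eq_zero]
    intro f hf
    have := hbound f
    rw [hf, norm_zero, mul_zero, norm_le_zero_iff] at this
    exact Subtype.ext this
  let N := LinearMap.range ρ
  let e := LinearEquiv.ofInjective ρ hinj
  have he : ∀ f, e.symm ⟨ρ f, LinearMap.mem_range_self ρ f⟩ = f := fun f =>
    e.symm_apply_apply f
  let φ : StrongDual ℂ N := LinearMap.mkContinuous
    ((innerₛₗ ℂ h).comp (S.domain.subtype.comp (e.symm : N →ₗ[ℂ] S.domain)))
    (‖h‖ * (√ε)⁻¹) <| by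
      rintro ⟨_, f, rfl⟩
      simp only [LinearMap.comp_apply, LinearEquiv.coe_coe, he, Submodule.subtype_apply,
        innerₛₗ_apply_apply]
      refine (norm_inner_le_norm _ _).trans ?_
      rw [mul_assoc]
      exact mul_le_mul_of_nonneg_left (hbound f) (norm_nonneg _)
  obtain ⟨ψ, hψ, -⟩ := exists_extension_norm_eq N φ
  set η := (InnerProductSpace.toDual ℂ H).symm ψ with hη_def
  have hη : ∀ f, inner ℂ η (ρ f) = inner ℂ h (f : H) := by
    intro f
    rw [hη_def, InnerProductSpace.toDual_symm_apply,
      hψ ⟨ρ f, LinearMap.mem_range_self ρ f⟩]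
    simp only [φ, LinearMap.mkContinuous_apply, LinearMap.comp_apply, LinearEquiv.coe_coe, he,
      Submodule.subtype_apply, innerₛₗ_apply_apply]
  let M := N.topologicalClosure
  have : CompleteSpace M := N.isClosed_topologicalClosure.completeSpace_coe
  -- Projecting the Riesz vector η onto the closed range keeps its products with every ρ f and makes
  -- it a limit of vectors ρ(u n). The u n then converge in H to the solution w of S_F w = h.
  have hξ : ∀ f, inner ℂ (ρ f) (M.starProjection η) = inner ℂ (f : H) h := by
    intro f
    have hf : ρ f ∈ M := N.le_topologicalClosure (LinearMap.mem_range_self ρ f)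
    rw [← Submodule.inner_starProjection_left_eq_right, Submodule.starProjection_eq_self_iff.2 hf,
      ← inner_conj_symm, hη, inner_conj_symm]
  set ξ := M.starProjection η
  have hξM : ξ ∈ closure (Set.range ρ) := Submodule.starProjection_apply_mem M η
  obtain ⟨v, hv, hvlim⟩ := mem_closure_iff_seq_limit.1 hξM
  choose u hu using hv
  have hlim : Tendsto (fun n => ρ (u n)) atTop (𝓝 ξ) := by simpa only [hu] using hvlim
  have hcauchy := cauchySeq_iff_tendsto_dist_atTop_0.1 hlim.cauchySeq
  have hdist : ∀ p : ℕ × ℕ, dist (ρ (u p.1)) (ρ (u p.2)) = ‖ρ (u p.1 - u p.2)‖ := fun p => by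
    rw [dist_eq_norm, map_sub]
  have hcauchyH : CauchySeq fun n => (u n : H) := by
    rw [cauchySeq_iff_tendsto_dist_atTop_0]
    have h1 := hcauchy.const_mul (√ε)⁻¹
    rw [mul_zero] at h1
    refine squeeze_zero (fun _ => dist_nonneg) (fun p => ?_) h1
    rw [hdist, dist_eq_norm]
    exact hbound (u p.1 - u p.2)
  obtain ⟨w, hw⟩ := cauchySeq_tendsto_of_complete hcauchyH
  have hwform : w ∈ closedFormDomain hS := by
    refine ⟨u, hw, ?_⟩
    have h1 := hcauchy.pow 2
    rw [zero_pow two_ne_zero] at h1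
    refine h1.congr fun p => ?_
    rw [hdist, hrn]
  have hwadj : (w, h) ∈ S.adjoint.graph := by
    rw [mem_adjoint_graph_iff hS.dense]
    intro f
    have h1 : Tendsto (fun n => inner ℂ (S f) (u n : H)) atTop (𝓝 (inner ℂ (S f) w)) :=
      tendsto_const_nhds.inner hw
    have h2 : Tendsto (fun n => inner ℂ (ρ f) (ρ (u n))) atTop (𝓝 (inner ℂ (ρ f) ξ)) :=
      tendsto_const_nhds.inner hlim
    rw [← hξ]
    refine tendsto_nhds_unique h1 (h2.congr fun n => ?_)
    exact (inner_eq_of_mem_graph hR.selfAdjoint (hrS f) (hr (u n))).symm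
  exact LinearPMap.mem_range_iff.2 ⟨w, mem_domRestrict_graph_iff.2 ⟨hwform, hwadj⟩⟩

end FormBound

/-! ### Dissipative and accretive extensions. -/

section Extension

variable {H : Type*} [NormedAddCommGroup H] [InnerProductSpace ℂ H] [CompleteSpace H]
  {S : H →ₗ.[ℂ] H} {hS : IsStrictlyPositiveSymmetric S}

theorem ExtensionData.op_apply (P : ExtensionData hS) (f : S.domain) (v : P.V)
    (h : (f : H) + v ∈ P.op.domain) :
    P.op ⟨f + v, h⟩ = Complex.I • S f + Complex.I • friedrichs hS (P.L v) :=
  LinearPMap.sup_apply _ (f := Complex.I • S) (g := P.onV) f v ⟨f + v, h⟩ rfl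

theorem ExtensionData.smul_le_op (P : ExtensionData hS) : Complex.I • S ≤ P.op :=
  LinearPMap.left_le_sup _ _ _

/-- The imaginary part of `⟨f + v, iSf + iS_F w⟩`, with the mixed terms collected by means of
`⟨f, S_F w⟩ = ⟨S f, w⟩`. -/
theorem im_inner_I_smul (hS : IsStrictlyPositiveSymmetric S) (f : S.domain) (v : H)
    (w : (friedrichs hS).domain) :
    (inner ℂ ((f : H) + v) (Complex.I • S f + Complex.I • friedrichs hS w)).im =
      quadForm S f + (inner ℂ v (friedrichs hS w)).re + (inner ℂ ((w : H) + v) (S f)).re := by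
  have h1 : (inner ℂ (f : H) (friedrichs hS w)).re = (inner ℂ (w : H) (S f)).re := by
    rw [inner_friedrichs, ← inner_conj_symm, Complex.conj_re]
  rw [← smul_add, inner_smul_right, Complex.I_mul_im]
  simp only [inner_add_left, inner_add_right, Complex.add_re, h1, quadForm]
  ring

/-- `A_{𝒱,ℒ}` is dissipative if and only if the pair `(𝒱, ℒ)` satisfies the condition. -/
theorem ExtensionData.isDissipative_op_iff (P : ExtensionData hS) :
    IsDissipative P.op ↔ P.Condition := by
  have hR := isNonnegSqrt_sqrt_krein hS
  constructor
  · intro hP v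
    obtain ⟨w, hw, hle⟩ := exists_sqrt_krein_of_quadForm_add_nonneg hS hR
      (u := (P.L v : H) + (v : H)) (c := (inner ℂ (v : H) (friedrichs hS (P.L v))).re) <| by
        intro f
        have hmem : (f : H) + v ∈ P.op.domain := Submodule.add_mem_sup f.2 v.2
        have h := hP.im_nonneg ⟨f + v, hmem⟩
        rwa [P.op_apply, im_inner_I_smul] at h
    refine ⟨LinearPMap.mem_domain_of_mem_graph hw, ?_⟩
    rwa [← (LinearPMap.image_iff (LinearPMap.mem_domain_of_mem_graph hw)).2 hw]
  · intro hP
    refine ⟨hS.dense.mono P.smul_le_op.1, ?_⟩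
    rintro ⟨x, hx⟩
    obtain ⟨f, hf, v, hv, rfl⟩ := Submodule.mem_sup.1 hx
    obtain ⟨h, hle⟩ := hP ⟨v, hv⟩
    rw [P.op_apply ⟨f, hf⟩ ⟨v, hv⟩ hx]
    have := im_inner_I_smul hS ⟨f, hf⟩ v (P.L ⟨v, hv⟩)
    rw [this]
    exact quadForm_add_re_inner_nonneg hS hR ((sqrt (krein S)).mem_graph ⟨_, h⟩) hle ⟨f, hf⟩

/-- Every dissipative extension of `iS` is of the form `A_{𝒱,ℒ}`. -/
theorem exists_extensionData (hS : IsStrictlyPositiveSymmetric S) {B : H →ₗ.[ℂ] H}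
    (hSB : Complex.I • S ≤ B) (hB : IsDissipative B) : ∃ P : ExtensionData hS, B = P.op := by
  have hR := isNonnegSqrt_sqrt_krein hS
  have hdom : S.domain ≤ B.domain := hSB.1
  obtain ⟨J, hJ⟩ := LinearMap.exists_rightInverse_of_surjective (friedrichs hS).toFun
    (LinearMap.range_eq_top.2 (friedrichs_surjective hS))
  have hJ' : ∀ h, friedrichs hS (J h) = h := fun h => LinearMap.congr_fun hJ h
  -- W is a purely algebraic complement in H; by the modular law W ∩ D(B) complements D(S) in D(B).
  obtain ⟨W, hW⟩ := Submodule.exists_isCompl S.domain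
  set V : Submodule ℂ H := W ⊓ B.domain
  have hsup : S.domain ⊔ V = B.domain := by
    rw [← sup_inf_assoc_of_le W hdom, hW.sup_eq_top, top_inf_eq]
  let L : V →ₗ[ℂ] (friedrichs hS).domain :=
    J ∘ₗ ((-Complex.I) • (B.toFun ∘ₗ Submodule.inclusion inf_le_right))
  have hL : ∀ v : V, Complex.I • friedrichs hS (L v) = B ⟨v, v.2.2⟩ := by
    intro v
    have h1 : friedrichs hS (L v) = (-Complex.I) • B ⟨v, v.2.2⟩ := hJ' _
    rw [h1, smul_smul]
    simp
  -- Dissipativity puts ℒv + v in D(S_K^{1/2}); since ℒv ∈ D(S_F) already lies there, so does v.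
  have hV : V ≤ (sqrt (krein S)).domain := by
    intro v hv
    have hLv : (L ⟨v, hv⟩ : H) ∈ (sqrt (krein S)).domain :=
      friedrichs_domain_le hS hR (L ⟨v, hv⟩).2
    obtain ⟨w, hw, -⟩ := exists_sqrt_krein_of_quadForm_add_nonneg hS hR
      (u := (L ⟨v, hv⟩ : H) + v) (c := (inner ℂ v (friedrichs hS (L ⟨v, hv⟩))).re) <| by
        intro f
        rw [← im_inner_I_smul, hL]
        have h := hB.im_nonneg (⟨f, hdom f.2⟩ + ⟨v, hv.2⟩)
        rw [LinearPMap.map_add, ← hSB.2 (x := f) (y := ⟨f, hdom f.2⟩) rfl] at h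
        exact h
    simpa using Submodule.sub_mem _ (LinearPMap.mem_domain_of_mem_graph hw) hLv
  let P : ExtensionData hS := ⟨V, hV, hW.disjoint.mono_right inf_le_left, L⟩
  refine ⟨P, (LinearPMap.eq_of_le_of_domain_eq ?_ hsup).symm⟩
  refine LinearPMap.sup_le _ hSB ⟨inf_le_right, ?_⟩
  rintro v ⟨y, hy⟩ (rfl : (v : H) = y)
  exact hL v

theorem isDissipative_extension_iff (hS : IsStrictlyPositiveSymmetric S) (B : H →ₗ.[ℂ] H) :
    (Complex.I • S ≤ B ∧ IsDissipative B) ↔ ∃ P : ExtensionData hS, P.Condition ∧ B = P.op := by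
  constructor
  · rintro ⟨hSB, hB⟩
    obtain ⟨P, rfl⟩ := exists_extensionData hS hSB hB
    exact ⟨P, P.isDissipative_op_iff.1 hB, rfl⟩
  · rintro ⟨P, hP, rfl⟩
    exact ⟨P.smul_le_op, P.isDissipative_op_iff.2 hP⟩

theorem isAccretive_extension_iff (hS : IsStrictlyPositiveSymmetric S) (C : H →ₗ.[ℂ] H) :
    (S ≤ C ∧ IsAccretive C) ↔
      ∃ P : ExtensionData hS, P.Condition ∧ C = (-Complex.I) • P.op := by
  have hI : ∀ T : H →ₗ.[ℂ] H, (-Complex.I) • Complex.I • T = T := fun T => by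
    rw [smul_smul]; simp
  have hI' : ∀ T : H →ₗ.[ℂ] H, Complex.I • (-Complex.I) • T = T := fun T => by
    rw [smul_smul]; simp
  have h1 : S ≤ C ↔ Complex.I • S ≤ Complex.I • C := by
    refine ⟨smul_le_smul_of_le _, fun h => ?_⟩
    have := smul_le_smul_of_le (-Complex.I) h
    rwa [hI, hI] at this
  rw [h1, IsAccretive, isDissipative_extension_iff hS]
  refine exists_congr fun P => and_congr_right fun _ => ⟨fun h => ?_, fun h => ?_⟩
  · rw [← h, hI]
  · rw [h, hI']

end Extension

end DissipativeExtension

end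

theorem theorem4p8 {H : Type*} [NormedAddCommGroup H] [InnerProductSpace ℂ H] [CompleteSpace H]
    (S : H →ₗ.[ℂ] H) (hS : IsStrictlyPositiveSymmetric S) :
    -- the square root `S_K^{1/2}` exists
    IsNonnegSqrt (krein S) (sqrt (krein S)) ∧
    -- `ℒ v + v ∈ D(S_K^{1/2})` always holds, so the condition is just the inequality
    (friedrichs hS).domain ≤ (sqrt (krein S)).domain ∧
    -- `A_{𝒱,ℒ}` is dissipative exactly when the condition holds
    (∀ P : ExtensionData hS, IsDissipative P.op ↔ P.Condition) ∧
    -- description of all dissipative extensions of `A = iS`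
    (∀ B : H →ₗ.[ℂ] H, (Complex.I • S ≤ B ∧ IsDissipative B) ↔
      ∃ P : ExtensionData hS, P.Condition ∧ B = P.op) ∧
    -- description of all accretive extensions of `S`
    (∀ C : H →ₗ.[ℂ] H, (S ≤ C ∧ IsAccretive C) ↔
      ∃ P : ExtensionData hS, P.Condition ∧ C = (-Complex.I) • P.op) := by
  exact ⟨isNonnegSqrt_sqrt_krein hS, friedrichs_domain_le hS (isNonnegSqrt_sqrt_krein hS),
    fun P => P.isDissipative_op_iff, isDissipative_extension_iff hS,
    isAccretive_extension_iff hS⟩
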